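/- Let $\mathcal M$ be a (Hausdorff, finite-dimensional) smooth manifold with an almost contact structure $(\varphi,\xi,\eta)$, i.e. an endomorphism field $\varphi$, a vector field $\xi$ and a 1-form $\eta$ with $\varphi^2=-I+\xi\otimes\eta$, $\varphi\xi=0$, $\eta\circ\varphi=0$, $\eta(\xi)=1$, and let $g$ be a pseudo-Riemannian metric with $g(\varphi x,\varphi y)=g(x,y)+\eta(x)\eta(y)$ for all vector fields $x,y$ (so that $\eta=-g(\xi,\cdot)$). Let $\nabla$ be the Levi-Civita connection of $g$, $F(x,y,z)=g((\nabla_x\varphi)y,z)$, $d\eta(x,y)=(\nabla_x\eta)y-(\nabla_y\eta)x$, and let $\mathfrak L_\xi g$ be the Lie derivative of $g$ along $\xi$. Put $\{x,y\}=\nabla_xy+\nabla_yx$ and $$[\varphi,\varphi](x,y)=\varphi^2[x,y]+[\varphi x,\varphi y]-\varphi[\varphi x,y]-\varphi[x,\varphi y],\qquad N=[\varphi,\varphi]+\xi\otimes d\eta,$$ $$\{\varphi,\varphi\}(x,y)=\varphi^2\{x,y\}+\{\varphi x,\varphi y\}-\varphi\{\varphi x,y\}-\varphi\{x,\varphi y\},\qquad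 \widehat N=\{\varphi,\varphi\}-\xi\otimes\mathfrak L_\xi g.$$ Then the following statements are equivalent: (i) $F(\varphi x,y,z)+F(\varphi y,x,z)+F(x,y,\varphi z)+F(y,x,\varphi z)=0$ for all vector fields $x,y,z$; (ii) $\widehat N=0$ and $\xi$ is a Killing vector field; (iii) $\{\varphi,\varphi\}=0$ and $\xi$ is a Killing vector field; (iv) the tensor $N(x,y,z)=g(N(x,y),z)$ is a 3-form and $\xi$ is a Killing vector field; (v) there exists exactly one linear connection $D$ with $D\varphi=D\xi=D\eta=Dg=0$ whose torsion $T(x,y,z)=g(D_xy-D_yx-[x,y],z)$ is totally skew-symmetric. -/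

import Mathlib

open scoped Manifold ContDiff Bundle

namespace PseudoRiemannian

section Fields

/-- Smooth vector fields on `M`, i.e. smooth sections of the tangent bundle. -/
abbrev 𝔛 (E M : Type*) [NormedAddCommGroup E] [NormedSpace ℝ E] [TopologicalSpace M]
    [ChartedSpace E M] [IsManifold 𝓘(ℝ, E) ∞ M] : Type _ :=
  Cₛ^∞⟮𝓘(ℝ, E); E, fun p : M => TangentSpace 𝓘(ℝ, E) p⟯

/-- Smooth sections of the bundle of endomorphisms of the tangent spaces. -/
abbrev EndField (E M : Type*) [NormedAddCommGroup E] [NormedSpace ℝ E] [TopologicalSpace M]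
    [ChartedSpace E M] [IsManifold 𝓘(ℝ, E) ∞ M] : Type _ :=
  Cₛ^∞⟮𝓘(ℝ, E); E →L[ℝ] E,
    fun p : M => TangentSpace 𝓘(ℝ, E) p →L[ℝ] TangentSpace 𝓘(ℝ, E) p⟯

/-- Smooth 1-forms on `M`. -/
abbrev OneForm (E M : Type*) [NormedAddCommGroup E] [NormedSpace ℝ E] [TopologicalSpace M]
    [ChartedSpace E M] [IsManifold 𝓘(ℝ, E) ∞ M] : Type _ :=
  Cₛ^∞⟮𝓘(ℝ, E); E →L[ℝ] ℝ, fun p : M => TangentSpace 𝓘(ℝ, E) p →L[ℝ] ℝ⟯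

/-- A smooth pseudo-Riemannian metric on `M` (of arbitrary signature). -/
structure Metric (E M : Type*) [NormedAddCommGroup E] [NormedSpace ℝ E] [TopologicalSpace M]
    [ChartedSpace E M] [IsManifold 𝓘(ℝ, E) ∞ M] where
  /-- the scalar product on each tangent space -/
  val (p : M) : TangentSpace 𝓘(ℝ, E) p →L[ℝ] TangentSpace 𝓘(ℝ, E) p →L[ℝ] ℝ
  symm (p : M) (u v : TangentSpace 𝓘(ℝ, E) p) : val p u v = val p v u
  nondegenerate (p : M) (u : TangentSpace 𝓘(ℝ, E) p) (hu : ∀ v, val p u v = 0) : u = 0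
  contMDiff : ContMDiff 𝓘(ℝ, E) (𝓘(ℝ, E).prod 𝓘(ℝ, E →L[ℝ] E →L[ℝ] ℝ)) ∞
    (fun p => Bundle.TotalSpace.mk' (E →L[ℝ] E →L[ℝ] ℝ)
      (E := fun p : M => TangentSpace 𝓘(ℝ, E) p →L[ℝ] TangentSpace 𝓘(ℝ, E) p →L[ℝ] ℝ) p (val p))

variable {E M : Type*} [NormedAddCommGroup E] [NormedSpace ℝ E] [TopologicalSpace M]
  [ChartedSpace E M] [IsManifold 𝓘(ℝ, E) ∞ M]

/-- The function `g(x, y)` on `M`. -/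
noncomputable def Metric.app (g : Metric E M) (x y : 𝔛 E M) : M → ℝ := fun p => g.val p (x p) (y p)

/-- The vector field `φ x`. -/
noncomputable def EndField.app (φ : EndField E M) (x : 𝔛 E M) : 𝔛 E M where
  toFun p := φ p (x p)
  contMDiff_toFun := φ.contMDiff.clm_bundle_apply x.contMDiff

/-- The function `η(x)` on `M`. -/
noncomputable def OneForm.app (η : OneForm E M) (x : 𝔛 E M) : M → ℝ := fun p => η p (x p)

/-- The derivative `x f` of a function `f` along the vector field `x`. -/
noncomputable def dir (x : 𝔛 E M) (f : M → ℝ) : M → ℝ := fun p => mvfderiv 𝓘(ℝ, E) f p (x p)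

/-- The product `f x` of a smooth function and a vector field. -/
noncomputable def fmul (f : C^∞⟮𝓘(ℝ, E), M; ℝ⟯) (x : 𝔛 E M) : 𝔛 E M where
  toFun p := f p • x p
  contMDiff_toFun := f.contMDiff.smul_section x.contMDiff

/-- The Lie bracket `[x, y]`. -/
noncomputable def lie [FiniteDimensional ℝ E] (x y : 𝔛 E M) : 𝔛 E M where
  toFun := VectorField.mlieBracket 𝓘(ℝ, E) x y
  contMDiff_toFun := by
    intro p
    have : IsManifold 𝓘(ℝ, E) (minSmoothness ℝ 2) M := by
      simpa using (inferInstance : IsManifold 𝓘(ℝ, E) 2 M)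
    have : IsManifold 𝓘(ℝ, E) ((((⊤ : ℕ∞) : WithTop ℕ∞)) + 1) M := by
      simpa using (inferInstance : IsManifold 𝓘(ℝ, E) ∞ M)
    exact ContMDiffAt.mlieBracket_vectorField (n := ⊤) (m := ⊤) (x.contMDiff p) (y.contMDiff p)
      (by simp)

end Fields

/-- A linear connection on `M`, as an operator `D` taking `x`, `y` to the vector field `D_x y`. -/
@[ext]
structure LinearConnection (E M : Type*) [NormedAddCommGroup E] [NormedSpace ℝ E]
    [TopologicalSpace M] [ChartedSpace E M] [IsManifold 𝓘(ℝ, E) ∞ M] where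
  /-- the vector field `D_x y` -/
  D : 𝔛 E M → 𝔛 E M → 𝔛 E M
  add_left (x x' y : 𝔛 E M) : D (x + x') y = D x y + D x' y
  fmul_left (f : C^∞⟮𝓘(ℝ, E), M; ℝ⟯) (x y : 𝔛 E M) : D (fmul f x) y = fmul f (D x y)
  add_right (x y y' : 𝔛 E M) : D x (y + y') = D x y + D x y'
  leibniz (f : C^∞⟮𝓘(ℝ, E), M; ℝ⟯) (x y : 𝔛 E M) (p : M) :
    D x (fmul f y) p = dir x f p • y p + f p • D x y p

set_option linter.unusedSectionVars false

section Existence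

variable {E M : Type*} [NormedAddCommGroup E] [NormedSpace ℝ E] [FiniteDimensional ℝ E]
  [TopologicalSpace M] [ChartedSpace E M] [IsManifold 𝓘(ℝ, E) ∞ M]


/-- The function `p ↦ g_p(X_p, Y_p)` for arbitrary (not necessarily smooth) vector fields. -/
noncomputable def Metric.appFun (g : Metric E M) (X Y : (p : M) → TangentSpace 𝓘(ℝ, E) p) : M → ℝ :=
  fun p => g.val p (X p) (Y p)

theorem Metric.contMDiffAt_appFun (g : Metric E M) {X Y : (p : M) → TangentSpace 𝓘(ℝ, E) p} {p : M}
    (hX : CMDiffAt ∞ (T% X) p) (hY : CMDiffAt ∞ (T% Y) p) :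
    CMDiffAt ∞ (g.appFun X Y) p := by
  have : ContMDiffAt 𝓘(ℝ, E) (𝓘(ℝ, E).prod 𝓘(ℝ)) ∞
      (fun m => Bundle.TotalSpace.mk' ℝ (E := Bundle.Trivial M ℝ) m (g.val m (X m) (Y m))) p := by
    apply ContMDiffAt.clm_bundle_apply₂ (F₁ := E) (F₂ := E)
    · exact g.contMDiff p
    · exact hX
    · exact hY
  simp only [Bundle.contMDiffAt_totalSpace] at this
  exact this.2

theorem Metric.mdiffAt_appFun (g : Metric E M) {X Y : (p : M) → TangentSpace 𝓘(ℝ, E) p} {p : M}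
    (hX : MDiffAt (T% X) p) (hY : MDiffAt (T% Y) p) :
    MDiffAt (g.appFun X Y) p := by
  have : MDifferentiableAt 𝓘(ℝ, E) (𝓘(ℝ, E).prod 𝓘(ℝ))
      (fun m => Bundle.TotalSpace.mk' ℝ (E := Bundle.Trivial M ℝ) m (g.val m (X m) (Y m))) p := by
    apply MDifferentiableAt.clm_bundle_apply₂ (F₁ := E) (F₂ := E)
    · exact (g.contMDiff p).mdifferentiableAt (by simp)
    · exact hX
    · exact hY
  simp only [mdifferentiableAt_totalSpace] at this
  exact this.2

/-- The Koszul expression for `2 g(∇_X Y, Z)`. -/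
noncomputable def Metric.koszul (g : Metric E M)
    (X Y Z : (p : M) → TangentSpace 𝓘(ℝ, E) p) (p : M) : ℝ :=
  mvfderiv 𝓘(ℝ, E) (g.appFun Y Z) p (X p) + mvfderiv 𝓘(ℝ, E) (g.appFun Z X) p (Y p)
    - mvfderiv 𝓘(ℝ, E) (g.appFun X Y) p (Z p)
    + g.val p (VectorField.mlieBracket 𝓘(ℝ, E) X Y p) (Z p)
    - g.val p (VectorField.mlieBracket 𝓘(ℝ, E) Y Z p) (X p)
    + g.val p (VectorField.mlieBracket 𝓘(ℝ, E) Z X p) (Y p)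

theorem Metric.appFun_add_left (g : Metric E M) (X X' Y : (p : M) → TangentSpace 𝓘(ℝ, E) p) :
    g.appFun (X + X') Y = g.appFun X Y + g.appFun X' Y := by
  ext p; simp [Metric.appFun]

theorem Metric.appFun_smul_left (g : Metric E M) (f : M → ℝ)
    (X Y : (p : M) → TangentSpace 𝓘(ℝ, E) p) :
    g.appFun (f • X) Y = f * g.appFun X Y := by
  ext p; simp [Metric.appFun]

theorem Metric.appFun_comm (g : Metric E M) (X Y : (p : M) → TangentSpace 𝓘(ℝ, E) p) :
    g.appFun X Y = g.appFun Y X := by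
  ext p; exact g.symm p _ _

theorem Metric.koszul_tensorial (g : Metric E M) {X Y : (p : M) → TangentSpace 𝓘(ℝ, E) p} {p : M}
    (hX : MDiffAt (T% X) p) (hY : MDiffAt (T% Y) p) :
    TensorialAt 𝓘(ℝ, E) E (fun Z => g.koszul X Y Z p) p where
  smul {f Z} hf hZ := by
    simp only [Metric.koszul, g.appFun_comm Y, g.appFun_smul_left]
    rw [mvfderiv_mul hf (g.mdiffAt_appFun hZ hY), mvfderiv_mul hf (g.mdiffAt_appFun hZ hX),
      VectorField.mlieBracket_smul_left hf hZ, VectorField.mlieBracket_smul_right hf hZ]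
    simp [Metric.appFun]
    rw [g.symm p (Z p) (X p)]
    ring
  add {Z Z'} hZ hZ' := by
    simp only [Metric.koszul, g.appFun_comm Y, g.appFun_add_left]
    rw [mvfderiv_add (g.mdiffAt_appFun hZ hY) (g.mdiffAt_appFun hZ' hY),
      mvfderiv_add (g.mdiffAt_appFun hZ hX) (g.mdiffAt_appFun hZ' hX),
      VectorField.mlieBracket_add_left hZ hZ', VectorField.mlieBracket_add_right hZ hZ']
    simp
    ring


theorem contMDiffAt_dir {f : M → ℝ} {X : (p : M) → TangentSpace 𝓘(ℝ, E) p} {p : M}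
    (hf : CMDiffAt ∞ f p) (hX : CMDiffAt ∞ (T% X) p) :
    CMDiffAt ∞ (fun q => mvfderiv 𝓘(ℝ, E) f q (X q)) p := by
  have h1 := hf.mfderiv_const (m := ∞) (by simp)
  have h2 := ContMDiffAt.clm_apply_of_inCoordinates h1 hX hf
  exact (contMDiff_snd_tangentBundle_modelSpace ℝ 𝓘(ℝ, ℝ)).contMDiffAt.comp p h2

theorem contMDiffAt_mlieBracket {X Y : (p : M) → TangentSpace 𝓘(ℝ, E) p} {p : M}
    (hX : CMDiffAt ∞ (T% X) p) (hY : CMDiffAt ∞ (T% Y) p) :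
    CMDiffAt ∞ (T% (VectorField.mlieBracket 𝓘(ℝ, E) X Y)) p := by
  have : IsManifold 𝓘(ℝ, E) (minSmoothness ℝ 2) M := by
    simpa using (inferInstance : IsManifold 𝓘(ℝ, E) 2 M)
  have : IsManifold 𝓘(ℝ, E) ((((⊤ : ℕ∞) : WithTop ℕ∞)) + 1) M := by
    simpa using (inferInstance : IsManifold 𝓘(ℝ, E) ∞ M)
  exact ContMDiffAt.mlieBracket_vectorField (n := ⊤) (m := ⊤) hX hY (by simp)

theorem Metric.contMDiffAt_koszul (g : Metric E M) {X Y Z : (p : M) → TangentSpace 𝓘(ℝ, E) p}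
    {p : M} (hX : CMDiffAt ∞ (T% X) p) (hY : CMDiffAt ∞ (T% Y) p) (hZ : CMDiffAt ∞ (T% Z) p) :
    CMDiffAt ∞ (g.koszul X Y Z) p :=
  ((((contMDiffAt_dir (g.contMDiffAt_appFun hY hZ) hX).add
    (contMDiffAt_dir (g.contMDiffAt_appFun hZ hX) hY)).sub
    (contMDiffAt_dir (g.contMDiffAt_appFun hX hY) hZ)).add
    (g.contMDiffAt_appFun (contMDiffAt_mlieBracket hX hY) hZ)).sub
    (g.contMDiffAt_appFun (contMDiffAt_mlieBracket hY hZ) hX) |>.add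
    (g.contMDiffAt_appFun (contMDiffAt_mlieBracket hZ hX) hY)

theorem Metric.exists_dual (g : Metric E M) (p : M) (l : TangentSpace 𝓘(ℝ, E) p →L[ℝ] ℝ) :
    ∃ v : TangentSpace 𝓘(ℝ, E) p, ∀ w, g.val p v w = l w := by
  have : FiniteDimensional ℝ (TangentSpace 𝓘(ℝ, E) p) := inferInstanceAs (FiniteDimensional ℝ E)
  let L : TangentSpace 𝓘(ℝ, E) p →ₗ[ℝ] Module.Dual ℝ (TangentSpace 𝓘(ℝ, E) p) :=
    { toFun := fun v => (g.val p v : TangentSpace 𝓘(ℝ, E) p →ₗ[ℝ] ℝ)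
      map_add' := fun v w => by ext; simp
      map_smul' := fun c v => by ext; simp }
  have hinj : Function.Injective L := by
    rw [injective_iff_map_eq_zero]
    intro v hv
    exact g.nondegenerate p v fun w => congrArg (fun φ => φ w) hv
  have hsurj : Function.Surjective L :=
    (LinearMap.injective_iff_surjective_of_finrank_eq_finrank
      (Subspace.dual_finrank_eq (K := ℝ) (V := TangentSpace 𝓘(ℝ, E) p)).symm).1 hinj
  obtain ⟨v, hv⟩ := hsurj (l : TangentSpace 𝓘(ℝ, E) p →ₗ[ℝ] ℝ)
  exact ⟨v, fun w => congrArg (fun φ => φ w) hv⟩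

/-- A vector field whose products with all locally defined smooth fields are smooth is smooth. -/
theorem Metric.contMDiffAt_of_app (g : Metric E M) {V : (p : M) → TangentSpace 𝓘(ℝ, E) p} {p : M}
    (h : ∀ Z : (p : M) → TangentSpace 𝓘(ℝ, E) p, CMDiffAt ∞ (T% Z) p →
      CMDiffAt ∞ (g.appFun V Z) p) : CMDiffAt ∞ (T% V) p := by
  let e := trivializationAt E (TangentSpace 𝓘(ℝ, E) : M → Type _) p
  have hp : p ∈ e.baseSet := FiberBundle.mem_baseSet_trivializationAt' p
  let ι := Fin (Module.finrank ℝ E)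
  let b : Module.Basis ι ℝ E := Module.finBasis ℝ E
  let s : ι → (p : M) → TangentSpace 𝓘(ℝ, E) p := e.localFrame b
  have hs (i : ι) : CMDiffAt ∞ (T% (s i)) p := contMDiffAt_localFrame_of_mem ∞ e b i hp
  let G : M → (ι → ℝ) →L[ℝ] (ι → ℝ) := fun m => ∑ i, ∑ j, g.appFun (s i) (s j) m •
    (ContinuousLinearMap.proj (R := ℝ) (φ := fun _ : ι => ℝ) i).smulRight
      (Pi.single j (1 : ℝ) : ι → ℝ)
  have hG : CMDiffAt ∞ G p := by
    refine contMDiffAt_finsetSum fun i _ => contMDiffAt_finsetSum fun j _ => ?_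
    exact (g.contMDiffAt_appFun (hs i) (hs j)).smul contMDiffAt_const
  have hGa (m : M) (a : ι → ℝ) (j : ι) : G m a j = g.val m (∑ i, a i • s i m) (s j m) := by
    simp [G, Metric.appFun, Pi.single_apply, mul_comm]
  let c : M → ι → ℝ := fun m j => g.appFun V (s j) m
  have hc : ContMDiffAt 𝓘(ℝ, E) 𝓘(ℝ, ι → ℝ) ∞ c p := contMDiffAt_pi_space.2 fun j => h _ (hs j)
  have hinj (m : M) (hm : m ∈ e.baseSet) : (G m).IsInvertible := by
    have hker : LinearMap.ker (G m : (ι → ℝ) →ₗ[ℝ] (ι → ℝ)) = ⊥ := by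
      rw [LinearMap.ker_eq_bot']
      intro a ha
      have h0 : ∑ i, a i • s i m = 0 := by
        refine g.nondegenerate m _ fun w => ?_
        have hw := (e.basisAt b hm).sum_repr w
        rw [← hw, map_sum]
        refine Finset.sum_eq_zero fun j _ => ?_
        have := congrFun ha j
        rw [map_smul]
        have h2 : s j m = e.basisAt b hm j := e.localFrame_apply_of_mem_baseSet b hm
        rw [← h2]
        have h3 := hGa m a j
        simp only [ContinuousLinearMap.coe_coe] at this
        rw [← h3, this]; simp
      have h1 := (e.basisAt b hm).linearIndependent
      rw [Fintype.linearIndependent_iff] at h1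
      ext i
      refine h1 a ?_ i
      rw [← h0]
      refine Finset.sum_congr rfl fun i _ => ?_
      rw [show s i m = e.basisAt b hm i from e.localFrame_apply_of_mem_baseSet b hm]
    exact ⟨ContinuousLinearEquiv.ofBijective (G m) hker
      (LinearMap.range_eq_top.2 ((LinearMap.injective_iff_surjective).1 (LinearMap.ker_eq_bot.1 hker))),
      by ext; simp⟩
  have hinv : ContMDiffAt 𝓘(ℝ, E) 𝓘(ℝ, ι → ℝ) ∞ (fun m => (G m).inverse (c m)) p := by
    have h1 : CMDiffAt ∞ (fun m => (G m).inverse) p :=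
      (ContinuousLinearMap.IsInvertible.contDiffAt_map_inverse (hinj p hp)).contMDiffAt.comp p hG
    exact h1.clm_apply hc
  have hV : ∀ m ∈ e.baseSet, V m = ∑ i, (G m).inverse (c m) i • s i m := by
    intro m hm
    have h1 : G m ((G m).inverse (c m)) = c m := by
      obtain ⟨A, hA⟩ := hinj m hm
      rw [← hA]; simp
    rw [← sub_eq_zero]
    refine g.nondegenerate m _ fun w => ?_
    rw [← (e.basisAt b hm).sum_repr w, map_sum]
    refine Finset.sum_eq_zero fun j _ => ?_
    rw [map_smul, ← show s j m = e.basisAt b hm j from e.localFrame_apply_of_mem_baseSet b hm,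
      map_sub, sub_apply, ← hGa, h1]
    simp [c, Metric.appFun]
  have hsum : CMDiffAt ∞ (T% (fun m => ∑ i, (G m).inverse (c m) i • s i m)) p := by
    refine ContMDiffAt.sum_section fun i _ => ?_
    exact ContMDiffAt.smul_section (contMDiffAt_pi_space.1 hinv i) (hs i)
  refine hsum.congr_of_eventuallyEq ?_
  filter_upwards [e.open_baseSet.mem_nhds hp] with m hm
  rw [hV m hm]

theorem Metric.exists_koszul (g : Metric E M) (X Y : 𝔛 E M) :
    ∃ V : 𝔛 E M, ∀ (p : M) (Z : (p : M) → TangentSpace 𝓘(ℝ, E) p), MDiffAt (T% Z) p →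
      g.val p (V p) (Z p) = 2⁻¹ * g.koszul X Y Z p := by
  have h (p : M) := g.exists_dual p ((2⁻¹ : ℝ) • TensorialAt.mkHom _ p
    (g.koszul_tensorial (X.mdifferentiableAt (x := p)) (Y.mdifferentiableAt (x := p))))
  choose V hV using h
  have hV' : ∀ (p : M) (Z : (p : M) → TangentSpace 𝓘(ℝ, E) p), MDiffAt (T% Z) p →
      g.val p (V p) (Z p) = 2⁻¹ * g.koszul X Y Z p := by
    intro p Z hZ
    rw [hV p (Z p)]
    simp only [smul_apply, smul_eq_mul]
    rw [TensorialAt.mkHom_apply _ hZ]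
  refine ⟨⟨V, fun p => g.contMDiffAt_of_app fun Z hZ => ?_⟩, hV'⟩
  have h1 : CMDiffAt ∞ (fun q => (2⁻¹ : ℝ) * g.koszul X Y Z q) p :=
    contMDiffAt_const.mul (g.contMDiffAt_koszul (X.contMDiff p) (Y.contMDiff p) hZ)
  refine h1.congr_of_eventuallyEq ?_
  have h2 : ∀ᶠ q in nhds p, CMDiffAt 1 (T% Z) q :=
    (contMDiffAt_iff_contMDiffAt_nhds (by simp)).1 (hZ.of_le (by simp))
  filter_upwards [h2] with q hq
  exact hV' q Z (hq.mdifferentiableAt (by simp))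

theorem Metric.ext_of_extend (g : Metric E M) {p : M} {u v : TangentSpace 𝓘(ℝ, E) p}
    (h : ∀ Z : (p : M) → TangentSpace 𝓘(ℝ, E) p, MDiffAt (T% Z) p →
      g.val p u (Z p) = g.val p v (Z p)) : u = v := by
  rw [← sub_eq_zero]
  refine g.nondegenerate p _ fun w => ?_
  have := h (FiberBundle.extend E w) (FiberBundle.mdifferentiableAt_extend _ _ _)
  simp only [FiberBundle.extend_apply_self] at this
  simp [this]

/-- The torsion `T(x, y) = D_x y - D_y x - [x, y]`. -/
noncomputable def LinearConnection.torsion (D : LinearConnection E M) (x y : 𝔛 E M) : 𝔛 E M :=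
  D.D x y - D.D y x - lie x y

/-- `D g`, i.e. `(D_x g)(y, z) = x g(y, z) - g(D_x y, z) - g(y, D_x z)`. -/
noncomputable def LinearConnection.covMetric (D : LinearConnection E M) (g : Metric E M)
    (x y z : 𝔛 E M) : M → ℝ :=
  dir x (g.app y z) - g.app (D.D x y) z - g.app y (D.D x z)

/-- `D` is a Levi-Civita connection of `g`: it is torsion-free and `D g = 0`. -/
structure IsLeviCivita (g : Metric E M) (D : LinearConnection E M) : Prop where
  torsion_eq_zero (x y : 𝔛 E M) : D.torsion x y = 0
  covMetric_eq_zero (x y z : 𝔛 E M) : D.covMetric g x y z = 0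

theorem exists_isLeviCivita (g : Metric E M) : ∃ D : LinearConnection E M, IsLeviCivita g D := by
  choose D hD using g.exists_koszul
  have hx (x : 𝔛 E M) (p : M) : MDiffAt (T% (x : (p : M) → TangentSpace 𝓘(ℝ, E) p)) p :=
    x.mdifferentiableAt
  have hf (f : C^∞⟮𝓘(ℝ, E), M; ℝ⟯) (p : M) : MDiffAt (f : M → ℝ) p := f.mdifferentiableAt
  have hco (f : C^∞⟮𝓘(ℝ, E), M; ℝ⟯) (x : 𝔛 E M) :
      (fmul f x : (p : M) → TangentSpace 𝓘(ℝ, E) p) = (f : M → ℝ) • ⇑x := rfl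
  refine ⟨⟨D, ?_, ?_, ?_, ?_⟩, ⟨?_, ?_⟩⟩
  · intro x x' y
    ext1 p
    refine g.ext_of_extend fun Z hZ => ?_
    rw [hD (x + x') y p Z hZ, ContMDiffSection.coe_add (D x y), Pi.add_apply, map_add, add_apply,
      hD x y p Z hZ, hD x' y p Z hZ]
    simp only [Metric.koszul, ContMDiffSection.coe_add, g.appFun_comm Z, g.appFun_add_left]
    rw [mvfderiv_add (g.mdiffAt_appFun (hx x p) hZ) (g.mdiffAt_appFun (hx x' p) hZ),
      mvfderiv_add (g.mdiffAt_appFun (hx x p) (hx y p)) (g.mdiffAt_appFun (hx x' p) (hx y p)),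
      VectorField.mlieBracket_add_left (hx x p) (hx x' p),
      VectorField.mlieBracket_add_right (hx x p) (hx x' p)]
    simp only [Pi.add_apply, map_add, add_apply]
    ring
  · intro f x y
    ext1 p
    refine g.ext_of_extend fun Z hZ => ?_
    rw [hD (fmul f x) y p Z hZ, hco f (D x y), Pi.smul_apply', map_smul, smul_apply,
      hD x y p Z hZ]
    simp only [Metric.koszul, hco, g.appFun_comm Z, g.appFun_smul_left]
    rw [mvfderiv_mul (hf f p) (g.mdiffAt_appFun (hx x p) hZ),
      mvfderiv_mul (hf f p) (g.mdiffAt_appFun (hx x p) (hx y p)),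
      VectorField.mlieBracket_smul_left (hf f p) (hx x p),
      VectorField.mlieBracket_smul_right (hf f p) (hx x p)]
    simp [Metric.appFun]
    rw [g.symm p (x p) (y p), g.symm p (x p) (Z p)]
    ring
  · intro x y y'
    ext1 p
    refine g.ext_of_extend fun Z hZ => ?_
    rw [hD x (y + y') p Z hZ, ContMDiffSection.coe_add (D x y), Pi.add_apply, map_add, add_apply,
      hD x y p Z hZ, hD x y' p Z hZ]
    simp only [Metric.koszul, ContMDiffSection.coe_add, g.appFun_comm x, g.appFun_add_left]
    rw [mvfderiv_add (g.mdiffAt_appFun (hx y p) hZ) (g.mdiffAt_appFun (hx y' p) hZ),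
      mvfderiv_add (g.mdiffAt_appFun (hx y p) (hx x p)) (g.mdiffAt_appFun (hx y' p) (hx x p)),
      VectorField.mlieBracket_add_left (hx y p) (hx y' p),
      VectorField.mlieBracket_add_right (hx y p) (hx y' p)]
    simp only [Pi.add_apply, map_add, add_apply]
    ring
  · intro f x y p
    refine g.ext_of_extend fun Z hZ => ?_
    rw [hD x (fmul f y) p Z hZ, map_add, add_apply, map_smul, map_smul, smul_apply, smul_apply,
      hD x y p Z hZ]
    simp only [Metric.koszul, hco, g.appFun_comm x, g.appFun_smul_left]
    rw [mvfderiv_mul (hf f p) (g.mdiffAt_appFun (hx y p) hZ),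
      mvfderiv_mul (hf f p) (g.mdiffAt_appFun (hx y p) (hx x p)),
      VectorField.mlieBracket_smul_left (hf f p) (hx y p),
      VectorField.mlieBracket_smul_right (hf f p) (hx y p)]
    simp [Metric.appFun, dir]
    ring
  · intro x y
    ext1 p
    refine g.ext_of_extend fun Z hZ => ?_
    change g.val p (D x y p - D y x p - VectorField.mlieBracket 𝓘(ℝ, E) x y p) (Z p)
      = g.val p 0 (Z p)
    rw [map_sub, map_sub, sub_apply, sub_apply, hD x y p Z hZ, hD y x p Z hZ]
    simp only [Metric.koszul, g.appFun_comm Z, g.appFun_comm (⇑y) (⇑x)]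
    rw [VectorField.mlieBracket_swap_apply (V := y) (W := x),
      VectorField.mlieBracket_swap_apply (V := Z) (W := y),
      VectorField.mlieBracket_swap_apply (V := Z) (W := x)]
    simp
    ring
  · intro x y z
    funext p
    change mvfderiv 𝓘(ℝ, E) (g.appFun y z) p (x p) - g.val p (D x y p) (z p)
        - g.val p (y p) (D x z p) = 0
    rw [g.symm p (y p), hD x y p z (hx z p), hD x z p y (hx y p)]
    simp only [Metric.koszul, g.appFun_comm z, g.appFun_comm (⇑y) (⇑x)]
    rw [VectorField.mlieBracket_swap_apply (V := z) (W := y),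
      VectorField.mlieBracket_swap_apply (V := z) (W := x),
      VectorField.mlieBracket_swap_apply (V := y) (W := x)]
    simp
    ring

end Existence

section Structures

variable {E M : Type*} [NormedAddCommGroup E] [NormedSpace ℝ E] [FiniteDimensional ℝ E]
  [TopologicalSpace M] [ChartedSpace E M] [IsManifold 𝓘(ℝ, E) ∞ M]

/-- The Levi-Civita connection `∇` of `g`. -/
noncomputable def leviCivita (g : Metric E M) : LinearConnection E M :=
  (exists_isLeviCivita g).choose

theorem isLeviCivita_leviCivita (g : Metric E M) : IsLeviCivita g (leviCivita g) :=
  (exists_isLeviCivita g).choose_spec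

/-- `(D_x φ) y = D_x (φ y) - φ (D_x y)`. -/
noncomputable def LinearConnection.covEnd (D : LinearConnection E M) (φ : EndField E M)
    (x y : 𝔛 E M) : 𝔛 E M :=
  D.D x (φ.app y) - φ.app (D.D x y)

/-- `(D_x η)(y) = x (η(y)) - η(D_x y)`. -/
noncomputable def LinearConnection.covOneForm (D : LinearConnection E M) (η : OneForm E M)
    (x y : 𝔛 E M) : M → ℝ :=
  dir x (η.app y) - η.app (D.D x y)

/-- The Lie derivative `(𝔏_ξ g)(x, y) = ξ g(x, y) - g([ξ, x], y) - g(x, [ξ, y])`. -/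
noncomputable def Metric.lieDeriv (g : Metric E M) (ξ x y : 𝔛 E M) : M → ℝ :=
  dir ξ (g.app x y) - g.app (lie ξ x) y - g.app x (lie ξ y)

/-- `ξ` is a Killing vector field of `g`. -/
def Metric.IsKilling (g : Metric E M) (ξ : 𝔛 E M) : Prop :=
  ∀ x y : 𝔛 E M, g.lieDeriv ξ x y = 0

/-- Total skew-symmetry of a `(0,3)`-tensor field (given by its values on vector fields), i.e. the
tensor field is a 3-form. The remaining transposition follows from these two. -/
structure IsTotallySkew (τ : 𝔛 E M → 𝔛 E M → 𝔛 E M → M → ℝ) : Prop where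
  skew_left (x y z : 𝔛 E M) : τ x y z = -τ y x z
  skew_right (x y z : 𝔛 E M) : τ x y z = -τ x z y

/-- The torsion as a `(0,3)`-tensor, `T(x, y, z) = g(T(x, y), z)`. -/
noncomputable def LinearConnection.torsion₃ (D : LinearConnection E M) (g : Metric E M)
    (x y z : 𝔛 E M) : M → ℝ :=
  g.app (D.torsion x y) z

end Structures

/-- A pseudo-Riemannian manifold with an almost contact metric structure `(φ, ξ, η, g)`. The
compatibility is `g(φx, φy) = g(x, y) + η(x) η(y)`, so that `η = -g(ξ, ·)` and `g(ξ, ξ) = -1`. -/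
structure AlmostContactMetric (E M : Type*) [NormedAddCommGroup E] [NormedSpace ℝ E]
    [TopologicalSpace M] [ChartedSpace E M] [IsManifold 𝓘(ℝ, E) ∞ M] where
  /-- the endomorphism field -/
  φ : EndField E M
  /-- the Reeb vector field -/
  ξ : 𝔛 E M
  /-- the contact form -/
  η : OneForm E M
  /-- the metric -/
  g : Metric E M
  φ_sq (p : M) (u : TangentSpace 𝓘(ℝ, E) p) : φ p (φ p u) = -u + η p u • ξ p
  φ_ξ (p : M) : φ p (ξ p) = 0
  η_φ (p : M) (u : TangentSpace 𝓘(ℝ, E) p) : η p (φ p u) = 0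
  η_ξ (p : M) : η p (ξ p) = 1
  compat (p : M) (u v : TangentSpace 𝓘(ℝ, E) p) :
    g.val p (φ p u) (φ p v) = g.val p u v + η p u * η p v

namespace AlmostContactMetric

variable {E M : Type*} [NormedAddCommGroup E] [NormedSpace ℝ E] [FiniteDimensional ℝ E]
  [TopologicalSpace M] [ChartedSpace E M] [IsManifold 𝓘(ℝ, E) ∞ M]

/-- The fundamental tensor `F(x, y, z) = g((∇_x φ) y, z)`. -/
noncomputable def F (S : AlmostContactMetric E M) (x y z : 𝔛 E M) : M → ℝ :=
  S.g.app ((leviCivita S.g).covEnd S.φ x y) z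

/-- `dη(x, y) = (∇_x η) y - (∇_y η) x`. -/
noncomputable def dη (S : AlmostContactMetric E M) (x y : 𝔛 E M) : M → ℝ :=
  (leviCivita S.g).covOneForm S.η x y - (leviCivita S.g).covOneForm S.η y x

/-- `[φ, φ](x, y) = φ² [x, y] + [φ x, φ y] - φ [φ x, y] - φ [x, φ y]`. -/
noncomputable def bracketφ (S : AlmostContactMetric E M) (x y : 𝔛 E M) : 𝔛 E M :=
  S.φ.app (S.φ.app (lie x y)) + lie (S.φ.app x) (S.φ.app y)
    - S.φ.app (lie (S.φ.app x) y) - S.φ.app (lie x (S.φ.app y))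

/-- The Nijenhuis tensor `N = [φ, φ] + ξ ⊗ dη`. -/
noncomputable def N (S : AlmostContactMetric E M) (x y : 𝔛 E M) (p : M) :
    TangentSpace 𝓘(ℝ, E) p :=
  S.bracketφ x y p + S.dη x y p • S.ξ p

/-- `N(x, y, z) = g(N(x, y), z)`. -/
noncomputable def N₃ (S : AlmostContactMetric E M) (x y z : 𝔛 E M) : M → ℝ :=
  fun p => S.g.val p (S.N x y p) (z p)

/-- The symmetric braces `{x, y} = ∇_x y + ∇_y x`. -/
noncomputable def braces (S : AlmostContactMetric E M) (x y : 𝔛 E M) : 𝔛 E M :=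
  (leviCivita S.g).D x y + (leviCivita S.g).D y x

/-- `{φ, φ}(x, y) = {φ x, φ y} + φ² {x, y} - φ {φ x, y} - φ {x, φ y}`. -/
noncomputable def bracesφ (S : AlmostContactMetric E M) (x y : 𝔛 E M) : 𝔛 E M :=
  S.braces (S.φ.app x) (S.φ.app y) + S.φ.app (S.φ.app (S.braces x y))
    - S.φ.app (S.braces (S.φ.app x) y) - S.φ.app (S.braces x (S.φ.app y))

/-- The associated Nijenhuis tensor `N̂ = {φ, φ} - ξ ⊗ 𝔏_ξ g`. -/
noncomputable def Nhat (S : AlmostContactMetric E M) (x y : 𝔛 E M) (p : M) :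
    TangentSpace 𝓘(ℝ, E) p :=
  S.bracesφ x y p - S.g.lieDeriv S.ξ x y p • S.ξ p

/-- `D` is a natural connection: `D φ = D ξ = D η = D g = 0`. -/
structure IsNatural (S : AlmostContactMetric E M) (D : LinearConnection E M) : Prop where
  φ_parallel (x y : 𝔛 E M) : D.covEnd S.φ x y = 0
  ξ_parallel (x : 𝔛 E M) : D.D x S.ξ = 0
  η_parallel (x y : 𝔛 E M) : D.covOneForm S.η x y = 0
  g_parallel (x y z : 𝔛 E M) : D.covMetric S.g x y z = 0

end AlmostContactMetric

end PseudoRiemannian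

/-! Everything is expressed through F and ∇η, where (∇_xη)y = -g(∇_xξ, y). F is skew in its last two
arguments, and moving φ between them costs only η-terms (`F_φ_middle`). Pairing {φ,φ}(x,y) with z
gives exactly the left side of (i) (`g_bracesφ`), so by nondegeneracy (i) means {φ,φ} = 0.
Substituting ξ into (i) makes ∇η skew, i.e. ξ is Killing (`FIdentity.nablaη_skew`). For Killing ξ
the tensors N̂ and {φ,φ} coincide, which settles (i)-(iii).

For (iv), put P(x,y,z) = F(φx,y,z) + F(x,y,φz) - (∇_xη)y η(z). It is always skew in y, z, and
N(x,y,z) = P(x,y,z) - P(y,x,z). For Killing ξ, (i) says that P is skew in x, y, hence a 3-form;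
conversely, if N is a 3-form then so is P.

For (v), let Q(x,y,z) = g(D_xy - ∇_xy, z). Dg = 0 and skew torsion make Q totally skew, and Dφ = 0
reads Q(x,φy,z) + Q(x,y,φz) = -F(x,y,z). These relations imply (i) (`IsNatural.fIdentity`), and with
Dη = 0 they determine Q as half of an explicit tensor T (`IsNatural.contorsion_eq`), whence
uniqueness. Conversely, under (i) the connection ∇ + T/2 has all the required properties
(`FIdentity.isNatural_of_eq`). -/

set_option linter.unusedSectionVars false

namespace PseudoRiemannian

/-! ### Global sections, duality, and the Levi-Civita connection -/

section Sections

variable {E M : Type*} [NormedAddCommGroup E] [NormedSpace ℝ E] [FiniteDimensional ℝ E]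
  [TopologicalSpace M] [ChartedSpace E M] [IsManifold 𝓘(ℝ, E) ∞ M]

/-- Every tangent vector extends to a globally defined smooth vector field. -/
theorem exists_section_eq [T2Space M] (p : M) (v : TangentSpace 𝓘(ℝ, E) p) :
    ∃ Z : 𝔛 E M, Z p = v := by
  obtain ⟨s, hs, hsm⟩ := FiberBundle.exists_contMDiffOn_extend (k := ∞) 𝓘(ℝ, E) E v
  -- The bump function has closed support inside the open set where the local extension is smooth,
  -- so the product is globally smooth; the value at p survives because f equals 1 there.
  obtain ⟨f, hf, -⟩ := (SmoothBumpFunction.nhds_basis_support (I := 𝓘(ℝ, E))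
    (interior_mem_nhds.2 hs)).mem_iff.1 (interior_mem_nhds.2 hs)
  refine ⟨⟨(f : M → ℝ) • FiberBundle.extend E v, ?_⟩, ?_⟩
  · exact ContMDiffOn.smul_section_of_tsupport f.contMDiff.contMDiffOn isOpen_interior hf
      (hsm.mono interior_subset)
  · change f p • FiberBundle.extend E v p = v
    rw [f.eq_one, FiberBundle.extend_apply_self, one_smul]

theorem Metric.eq_of_app_eq [T2Space M] (g : Metric E M) {X Y : 𝔛 E M}
    (h : ∀ z : 𝔛 E M, g.app X z = g.app Y z) : X = Y := by
  ext1 p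
  rw [← sub_eq_zero]
  refine g.nondegenerate p _ fun w => ?_
  obtain ⟨z, rfl⟩ := exists_section_eq p w
  have := congrFun (h z) p
  simp only [Metric.app] at this
  simp [this]

theorem Metric.eq_zero_of_app_eq_zero [T2Space M] (g : Metric E M) {X : 𝔛 E M}
    (h : ∀ z : 𝔛 E M, g.app X z = 0) : X = 0 := by
  refine g.eq_of_app_eq fun z => ?_
  rw [h z]
  funext p
  simp [Metric.app]

theorem Metric.contMDiff_app (g : Metric E M) (x y : 𝔛 E M) :
    ContMDiff 𝓘(ℝ, E) 𝓘(ℝ) ∞ (g.app x y) :=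
  fun p => g.contMDiffAt_appFun (x.contMDiff p) (y.contMDiff p)

/-- The smooth function `g(x, y)`. -/
noncomputable def Metric.smoothApp (g : Metric E M) (x y : 𝔛 E M) : C^∞⟮𝓘(ℝ, E), M; ℝ⟯ :=
  ⟨g.app x y, g.contMDiff_app x y⟩

@[simp]
theorem Metric.smoothApp_apply (g : Metric E M) (x y : 𝔛 E M) (p : M) :
    g.smoothApp x y p = g.val p (x p) (y p) := rfl

@[simp]
theorem EndField.app_apply (φ : EndField E M) (x : 𝔛 E M) (p : M) : φ.app x p = φ p (x p) := rfl

@[simp]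
theorem fmul_apply (f : C^∞⟮𝓘(ℝ, E), M; ℝ⟯) (x : 𝔛 E M) (p : M) : fmul f x p = f p • x p := rfl

@[simp]
theorem section_add_apply (x y : 𝔛 E M) (p : M) : (x + y) p = x p + y p := rfl

@[simp]
theorem section_sub_apply (x y : 𝔛 E M) (p : M) : (x - y) p = x p - y p := rfl

@[simp]
theorem section_neg_apply (x : 𝔛 E M) (p : M) : (-x) p = -x p := rfl

@[simp]
theorem section_zero_apply (p : M) : (0 : 𝔛 E M) p = 0 := rfl

theorem EndField.app_add (φ : EndField E M) (x y : 𝔛 E M) :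
    φ.app (x + y) = φ.app x + φ.app y := by
  ext1 p; simp

theorem EndField.app_fmul (φ : EndField E M) (f : C^∞⟮𝓘(ℝ, E), M; ℝ⟯) (x : 𝔛 E M) :
    φ.app (fmul f x) = fmul f (φ.app x) := by
  ext1 p; simp

namespace LinearConnection

variable (D : LinearConnection E M)

theorem neg_left (x y : 𝔛 E M) : D.D (-x) y = -D.D x y :=
  map_neg (AddMonoidHom.mk' (fun x => D.D x y) fun a b => D.add_left a b y) x

theorem neg_right (x y : 𝔛 E M) : D.D x (-y) = -D.D x y :=
  map_neg (AddMonoidHom.mk' (D.D x) (D.add_right x)) y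

theorem zero_left (y : 𝔛 E M) : D.D 0 y = 0 :=
  map_zero (AddMonoidHom.mk' (fun x => D.D x y) fun a b => D.add_left a b y)

theorem zero_right (x : 𝔛 E M) : D.D x 0 = 0 :=
  map_zero (AddMonoidHom.mk' (D.D x) (D.add_right x))

theorem dir_app {g : Metric E M} (h : ∀ x y z : 𝔛 E M, D.covMetric g x y z = 0)
    (x y z : 𝔛 E M) (p : M) :
    dir x (g.app y z) p = g.val p (D.D x y p) (z p) + g.val p (y p) (D.D x z p) := by
  have := congrFun (h x y z) p
  simp only [covMetric, Metric.app, Pi.sub_apply, Pi.zero_apply] at this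
  linarith

theorem covEnd_add_left (φ : EndField E M) (x x' y : 𝔛 E M) :
    D.covEnd φ (x + x') y = D.covEnd φ x y + D.covEnd φ x' y := by
  simp only [covEnd, D.add_left, φ.app_add]
  abel

theorem covEnd_fmul_left (φ : EndField E M) (f : C^∞⟮𝓘(ℝ, E), M; ℝ⟯) (x y : 𝔛 E M) :
    D.covEnd φ (fmul f x) y = fmul f (D.covEnd φ x y) := by
  ext1 p
  simp [covEnd, D.fmul_left, smul_sub]

theorem covEnd_add_right (φ : EndField E M) (x y y' : 𝔛 E M) :
    D.covEnd φ x (y + y') = D.covEnd φ x y + D.covEnd φ x y' := by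
  simp only [covEnd, D.add_right, φ.app_add]
  abel

theorem covEnd_fmul_right (φ : EndField E M) (f : C^∞⟮𝓘(ℝ, E), M; ℝ⟯) (x y : 𝔛 E M) :
    D.covEnd φ x (fmul f y) = fmul f (D.covEnd φ x y) := by
  ext1 p
  simp [covEnd, D.leibniz, φ.app_fmul, smul_sub]

end LinearConnection

theorem leviCivita_covMetric (g : Metric E M) (x y z : 𝔛 E M) :
    (leviCivita g).covMetric g x y z = 0 :=
  (isLeviCivita_leviCivita g).covMetric_eq_zero x y z

theorem lie_eq_leviCivita (g : Metric E M) (x y : 𝔛 E M) :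
    lie x y = (leviCivita g).D x y - (leviCivita g).D y x := by
  have := (isLeviCivita_leviCivita g).torsion_eq_zero x y
  rw [LinearConnection.torsion, sub_eq_zero] at this
  exact this.symm

theorem lie_apply_eq_leviCivita (g : Metric E M) (x y : 𝔛 E M) (p : M) :
    VectorField.mlieBracket 𝓘(ℝ, E) x y p
      = (leviCivita g).D x y p - (leviCivita g).D y x p :=
  congrArg (fun X : 𝔛 E M => X p) (lie_eq_leviCivita g x y)

theorem koszul_eq_leviCivita (g : Metric E M) (x y z : 𝔛 E M) (p : M) :
    g.koszul x y z p = 2 * g.val p ((leviCivita g).D x y p) (z p) := by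
  have h1 := (leviCivita g).dir_app (leviCivita_covMetric g) x y z p
  have h2 := (leviCivita g).dir_app (leviCivita_covMetric g) y z x p
  have h3 := (leviCivita g).dir_app (leviCivita_covMetric g) z x y p
  simp only [dir] at h1 h2 h3
  simp only [Metric.koszul, lie_apply_eq_leviCivita g]
  rw [show g.appFun y z = g.app y z from rfl, show g.appFun z x = g.app z x from rfl,
    show g.appFun x y = g.app x y from rfl, h1, h2, h3]
  simp only [map_sub, sub_apply]
  rw [g.symm p (x p), g.symm p (y p), g.symm p (z p)]
  ring

/-- `LinearConnection.D` accepts only global fields, while the Koszul expression also makes sense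
for local ones. Tensoriality in the direction X turns it into a functional on each tangent space,
needed to dualize terms such as F(φz, x, y), where z is the direction of differentiation. -/
theorem Metric.koszul_tensorial_left (g : Metric E M) {Y Z : (p : M) → TangentSpace 𝓘(ℝ, E) p}
    {p : M} (hY : MDiffAt (T% Y) p) (hZ : MDiffAt (T% Z) p) :
    TensorialAt 𝓘(ℝ, E) E (fun X => g.koszul X Y Z p) p where
  smul {f X} hf hX := by
    simp only [Metric.koszul, g.appFun_comm Z, g.appFun_smul_left]
    rw [mvfderiv_mul hf (g.mdiffAt_appFun hX hZ), mvfderiv_mul hf (g.mdiffAt_appFun hX hY),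
      VectorField.mlieBracket_smul_left hf hX, VectorField.mlieBracket_smul_right hf hX]
    simp [Metric.appFun]
    rw [g.symm p (X p) (Y p), g.symm p (X p) (Z p)]
    ring
  add {X X'} hX hX' := by
    simp only [Metric.koszul, g.appFun_comm Z, g.appFun_add_left]
    rw [mvfderiv_add (g.mdiffAt_appFun hX hZ) (g.mdiffAt_appFun hX' hZ),
      mvfderiv_add (g.mdiffAt_appFun hX hY) (g.mdiffAt_appFun hX' hY),
      VectorField.mlieBracket_add_left hX hX', VectorField.mlieBracket_add_right hX hX']
    simp
    ring

/-- The 1-form `z ↦ g(∇_z x, y)` is dual to a smooth vector field. -/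
theorem Metric.exists_dual_leviCivita (g : Metric E M) (x y : 𝔛 E M) :
    ∃ V : 𝔛 E M, ∀ (z : 𝔛 E M) (p : M),
      g.val p (V p) (z p) = g.val p ((leviCivita g).D z x p) (y p) := by
  have h (p : M) := g.exists_dual p ((2⁻¹ : ℝ) • TensorialAt.mkHom _ p
    (g.koszul_tensorial_left (x.mdifferentiableAt (x := p)) (y.mdifferentiableAt (x := p))))
  choose V hV using h
  have hV' : ∀ (p : M) (Z : (p : M) → TangentSpace 𝓘(ℝ, E) p), MDiffAt (T% Z) p →
      g.val p (V p) (Z p) = 2⁻¹ * g.koszul Z x y p := by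
    intro p Z hZ
    rw [hV p (Z p)]
    simp only [smul_apply, smul_eq_mul]
    rw [TensorialAt.mkHom_apply _ hZ]
  refine ⟨⟨V, fun p => g.contMDiffAt_of_app fun Z hZ => ?_⟩, fun z p => ?_⟩
  · have h1 : CMDiffAt ∞ (fun q => (2⁻¹ : ℝ) * g.koszul Z x y q) p :=
      contMDiffAt_const.mul (g.contMDiffAt_koszul hZ (x.contMDiff p) (y.contMDiff p))
    refine h1.congr_of_eventuallyEq ?_
    have h2 : ∀ᶠ q in nhds p, CMDiffAt 1 (T% Z) q :=
      (contMDiffAt_iff_contMDiffAt_nhds (by simp)).1 (hZ.of_le (by simp))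
    filter_upwards [h2] with q hq
    exact hV' q Z (hq.mdifferentiableAt (by simp))
  · refine (hV' p z z.mdifferentiableAt).trans ?_
    rw [koszul_eq_leviCivita]
    ring

theorem Metric.lieDeriv_eq (g : Metric E M) (ξ x y : 𝔛 E M) (p : M) :
    g.lieDeriv ξ x y p = g.val p ((leviCivita g).D x ξ p) (y p)
      + g.val p ((leviCivita g).D y ξ p) (x p) := by
  simp only [Metric.lieDeriv, Pi.sub_apply,
    (leviCivita g).dir_app (leviCivita_covMetric g), lie_eq_leviCivita g, Metric.app,
    section_sub_apply, map_sub, sub_apply]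
  rw [g.symm p (x p), g.symm p (x p)]
  ring

end Sections

/-! ### Identities for F and ∇η valid for every structure -/

namespace AlmostContactMetric

variable {E M : Type*} [NormedAddCommGroup E] [NormedSpace ℝ E] [FiniteDimensional ℝ E]
  [TopologicalSpace M] [ChartedSpace E M] [IsManifold 𝓘(ℝ, E) ∞ M]
  (S : AlmostContactMetric E M)

theorem g_ξ_left (p : M) (u : TangentSpace 𝓘(ℝ, E) p) : S.g.val p (S.ξ p) u = -S.η p u := by
  have := S.compat p (S.ξ p) u
  rw [S.φ_ξ, S.η_ξ, map_zero, zero_apply] at this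
  linarith

theorem g_ξ_right (p : M) (u : TangentSpace 𝓘(ℝ, E) p) : S.g.val p u (S.ξ p) = -S.η p u := by
  rw [S.g.symm, S.g_ξ_left]

theorem g_φ_left (p : M) (u v : TangentSpace 𝓘(ℝ, E) p) :
    S.g.val p (S.φ p u) v = -S.g.val p u (S.φ p v) := by
  have := S.compat p (S.φ p u) v
  rw [S.φ_sq, S.η_φ, map_add, map_neg, map_smul, add_apply, neg_apply, smul_apply, S.g_ξ_left,
    S.η_φ] at this
  simp only [smul_eq_mul] at this
  linarith

theorem η_app_eq (x : 𝔛 E M) : S.η.app x = S.g.app (-S.ξ) x := by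
  funext p
  simp [OneForm.app, Metric.app, S.g_ξ_left]

/-- Since η = -g(ξ, ·), the function η(x) is bundled as `S.g.smoothApp (-S.ξ) x`, the form that the
Leibniz rule requires. -/
theorem φφ_app (x : 𝔛 E M) :
    S.φ.app (S.φ.app x) = -x + fmul (S.g.smoothApp (-S.ξ) x) S.ξ := by
  ext1 p
  simp [S.φ_sq, S.g_ξ_left]

theorem φ_app_ξ : S.φ.app S.ξ = 0 := by
  ext1 p
  simp [S.φ_ξ]

/-- The covariant derivative `(∇_x η) y`. -/
noncomputable def nablaη (x y : 𝔛 E M) : M → ℝ := (leviCivita S.g).covOneForm S.η x y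

theorem dir_η_app (x y : 𝔛 E M) (p : M) :
    dir x (S.η.app y) p
      = -S.g.val p ((leviCivita S.g).D x S.ξ p) (y p) + S.η p ((leviCivita S.g).D x y p) := by
  rw [η_app_eq, (leviCivita S.g).dir_app (leviCivita_covMetric S.g), LinearConnection.neg_right]
  simp [S.g_ξ_left]

theorem nablaη_eq (x y : 𝔛 E M) (p : M) :
    S.nablaη x y p = -S.g.val p ((leviCivita S.g).D x S.ξ p) (y p) := by
  rw [nablaη, LinearConnection.covOneForm, Pi.sub_apply, dir_η_app, OneForm.app]
  ring

/-- Differentiating the constant η(ξ) = 1 shows that ∇_xξ is orthogonal to ξ. -/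
theorem nablaη_ξ (x : 𝔛 E M) (p : M) : S.nablaη x S.ξ p = 0 := by
  have h : S.η.app S.ξ = fun _ => 1 := by
    funext p
    simp [OneForm.app, S.η_ξ]
  have h1 := S.dir_η_app x S.ξ p
  rw [h, S.g_ξ_right] at h1
  simp only [dir, mvfderiv_const, zero_apply] at h1
  rw [S.nablaη_eq, S.g_ξ_right]
  linarith

theorem nablaη_φφ_right (x y : 𝔛 E M) (p : M) :
    S.nablaη x (S.φ.app (S.φ.app y)) p = -S.nablaη x y p := by
  have := S.nablaη_ξ x p
  rw [nablaη_eq] at this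
  rw [φφ_app]
  simp only [nablaη_eq]
  simp only [section_add_apply, section_neg_apply, fmul_apply, map_add, map_neg, map_smul,
    smul_eq_mul]
  linear_combination (S.g.smoothApp (-S.ξ) y p) * this

theorem lieDeriv_ξ_eq (x y : 𝔛 E M) (p : M) :
    S.g.lieDeriv S.ξ x y p = -S.nablaη x y p - S.nablaη y x p := by
  rw [Metric.lieDeriv_eq, nablaη_eq, nablaη_eq]
  ring

theorem isKilling_iff : S.g.IsKilling S.ξ ↔
    ∀ (x y : 𝔛 E M) (p : M), S.nablaη x y p + S.nablaη y x p = 0 := by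
  constructor
  · intro h x y p
    have := congrFun (h x y) p
    rw [lieDeriv_ξ_eq, Pi.zero_apply] at this
    linarith
  · intro h x y
    funext p
    rw [lieDeriv_ξ_eq, Pi.zero_apply]
    linarith [h x y p]

theorem F_apply (x y z : 𝔛 E M) (p : M) :
    S.F x y z p = S.g.val p ((leviCivita S.g).D x (S.φ.app y) p) (z p)
      + S.g.val p ((leviCivita S.g).D x y p) (S.φ p (z p)) := by
  simp [F, Metric.app, LinearConnection.covEnd, S.g_φ_left]

/-- φ is skew-adjoint for g and ∇g = 0, so ∇_xφ is skew-adjoint too. -/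
theorem F_swap_right (x y z : 𝔛 E M) (p : M) : S.F x y z p = -S.F x z y p := by
  have h : S.g.app (S.φ.app y) z = -S.g.app y (S.φ.app z) := by
    funext p
    simp [Metric.app, S.g_φ_left]
  have h1 := (leviCivita S.g).dir_app (leviCivita_covMetric S.g) x (S.φ.app y) z p
  have h2 := (leviCivita S.g).dir_app (leviCivita_covMetric S.g) x y (S.φ.app z) p
  simp only [h, dir, mvfderiv_neg, neg_apply] at h1 h2
  simp only [F_apply]
  rw [S.g.symm p _ (y p), S.g.symm p _ (S.φ p (y p))]
  simp only [EndField.app_apply] at h1 h2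
  linarith

theorem F_φφ_left (x y z : 𝔛 E M) (p : M) :
    S.F (S.φ.app (S.φ.app x)) y z p = -S.F x y z p + S.η p (x p) * S.F S.ξ y z p := by
  rw [φφ_app]
  simp only [F_apply, LinearConnection.add_left, LinearConnection.neg_left,
    LinearConnection.fmul_left]
  simp [S.g_ξ_left]
  ring

theorem F_φφ_right (x y z : 𝔛 E M) (p : M) :
    S.F x y (S.φ.app (S.φ.app z)) p = -S.F x y z p + S.η p (z p) * S.F x y S.ξ p := by
  rw [φφ_app]
  simp [F, Metric.app, S.g_ξ_left]

/-- This is the covariant derivative of φ² = -I + ξ ⊗ η, combined with skew-adjointness of φ. -/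
theorem F_φ_middle (x y z : 𝔛 E M) (p : M) :
    S.F x (S.φ.app y) z p = S.F x y (S.φ.app z) p
      - S.nablaη x y p * S.η p (z p) - S.η p (y p) * S.nablaη x z p := by
  have h : (leviCivita S.g).D x (S.φ.app (S.φ.app y)) p = -(leviCivita S.g).D x y p
      + dir x (S.η.app y) p • S.ξ p + S.η p (y p) • (leviCivita S.g).D x S.ξ p := by
    rw [φφ_app, LinearConnection.add_right, LinearConnection.neg_right, section_add_apply,
      LinearConnection.leibniz, η_app_eq]
    simp only [section_neg_apply, Metric.smoothApp_apply, map_neg, neg_apply, S.g_ξ_left, neg_neg,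
      add_assoc]
    rfl
  simp only [F_apply, h, S.dir_η_app, nablaη_eq, EndField.app_apply, S.φ_sq]
  simp only [map_add, map_neg, map_smul, add_apply, neg_apply, smul_apply, smul_eq_mul,
    S.g_ξ_left, S.g_ξ_right]
  have h2 := S.nablaη_ξ x p
  ring

theorem F_ξ_middle (x z : 𝔛 E M) (p : M) : S.F x S.ξ z p = -S.nablaη x (S.φ.app z) p := by
  rw [F_apply, φ_app_ξ, LinearConnection.zero_right, nablaη_eq]
  simp

theorem F_φ_ξ_left (y z : 𝔛 E M) (p : M) : S.F (S.φ.app S.ξ) y z p = 0 := by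
  rw [φ_app_ξ, F_apply, LinearConnection.zero_left, LinearConnection.zero_left]
  simp

theorem F_φ_ξ_right (x y : 𝔛 E M) (p : M) : S.F x y (S.φ.app S.ξ) p = 0 := by
  rw [φ_app_ξ]
  simp [F, Metric.app]

theorem η_app_apply_φ (x : 𝔛 E M) (p : M) : S.η p (S.φ.app x p) = 0 := S.η_φ p _

/-! ### Both Nijenhuis tensors in terms of F -/

theorem g_bracesφ (x y z : 𝔛 E M) (p : M) :
    S.g.val p (S.bracesφ x y p) (z p)
      = S.F (S.φ.app x) y z p + S.F (S.φ.app y) x z p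
        + S.F x y (S.φ.app z) p + S.F y x (S.φ.app z) p := by
  simp only [bracesφ, braces, F, Metric.app, LinearConnection.covEnd, section_add_apply,
    section_sub_apply, EndField.app_apply, map_add, map_sub, add_apply, sub_apply, S.g_φ_left]
  ring

theorem g_bracketφ (x y z : 𝔛 E M) (p : M) :
    S.g.val p (S.bracketφ x y p) (z p)
      = S.F (S.φ.app x) y z p - S.F (S.φ.app y) x z p
        + S.F x y (S.φ.app z) p - S.F y x (S.φ.app z) p := by
  simp only [bracketφ, lie_eq_leviCivita S.g, F, Metric.app, LinearConnection.covEnd,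
    section_add_apply, section_sub_apply, EndField.app_apply, map_add, map_sub, add_apply,
    sub_apply, S.g_φ_left]
  ring

theorem N₃_apply (x y z : 𝔛 E M) (p : M) :
    S.N₃ x y z p = S.F (S.φ.app x) y z p - S.F (S.φ.app y) x z p
        + S.F x y (S.φ.app z) p - S.F y x (S.φ.app z) p
        - (S.nablaη x y p - S.nablaη y x p) * S.η p (z p) := by
  simp only [N₃, N, map_add, add_apply, g_bracketφ, map_smul, smul_apply, S.g_ξ_left, dη,
    Pi.sub_apply, nablaη, smul_eq_mul]
  ring

/-! ### Consequences of the F-identity, and its equivalence with the 3-form condition -/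

/-- The identity for `F` characterizing the class, evaluated pointwise. -/
def FIdentity : Prop := ∀ (x y z : 𝔛 E M) (p : M),
  S.F (S.φ.app x) y z p + S.F (S.φ.app y) x z p
    + S.F x y (S.φ.app z) p + S.F y x (S.φ.app z) p = 0

theorem fIdentity_iff : S.FIdentity ↔ ∀ x y z : 𝔛 E M,
    S.F (S.φ.app x) y z + S.F (S.φ.app y) x z + S.F x y (S.φ.app z) + S.F y x (S.φ.app z) = 0 :=
  ⟨fun h x y z => funext (h x y z), fun h x y z p => congrFun (h x y z) p⟩

theorem fIdentity_iff_bracesφ_eq_zero [T2Space M] :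
    S.FIdentity ↔ ∀ x y : 𝔛 E M, S.bracesφ x y = 0 := by
  constructor
  · intro h x y
    refine S.g.eq_zero_of_app_eq_zero fun z => funext fun p => ?_
    rw [Metric.app, g_bracesφ]
    exact h x y z p
  · intro h x y z p
    rw [← g_bracesφ, h x y]
    simp

variable {S}

/-- Taking x = y = ξ leaves only 2F(ξ, ξ, φz), which equals 2(∇_ξη)z. -/
theorem FIdentity.nablaη_ξ_left (h : S.FIdentity) (z : 𝔛 E M) (p : M) :
    S.nablaη S.ξ z p = 0 := by
  have h1 := h S.ξ S.ξ z p
  rw [S.F_φ_ξ_left, S.F_ξ_middle, S.nablaη_φφ_right] at h1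
  linarith

theorem FIdentity.F_ξ_left_φ (h : S.FIdentity) (y z : 𝔛 E M) (p : M) :
    S.F S.ξ y (S.φ.app z) p = S.nablaη (S.φ.app y) (S.φ.app z) p - S.nablaη y z p := by
  have h1 := h S.ξ y z p
  rw [S.F_φ_ξ_left, S.F_ξ_middle, S.F_ξ_middle, S.nablaη_φφ_right] at h1
  linarith

/-- With z = ξ the identity gives skewness on φx, φy (`hφ`). Then `F_ξ_left_φ` and the vanishing of
∇_ξη carry it over to x, y: F(ξ, x, φy) is skew in x, y because F(ξ, φx, y) = F(ξ, x, φy). -/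
theorem FIdentity.nablaη_skew (h : S.FIdentity) (x y : 𝔛 E M) (p : M) :
    S.nablaη x y p + S.nablaη y x p = 0 := by
  have hφ : S.nablaη (S.φ.app x) (S.φ.app y) p + S.nablaη (S.φ.app y) (S.φ.app x) p = 0 := by
    have h1 := h x y S.ξ p
    rw [S.F_φ_ξ_right, S.F_φ_ξ_right, S.F_swap_right, S.F_ξ_middle,
      S.F_swap_right (S.φ.app y), S.F_ξ_middle] at h1
    linarith
  have h1 := S.F_φ_middle S.ξ x y p
  rw [S.F_swap_right S.ξ (S.φ.app x) y, h.F_ξ_left_φ, h.F_ξ_left_φ, h.nablaη_ξ_left,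
    h.nablaη_ξ_left] at h1
  linarith

theorem FIdentity.F_ξ_left (h : S.FIdentity) (x y : 𝔛 E M) (p : M) :
    S.F S.ξ x y p = S.nablaη (S.φ.app x) y p + S.nablaη x (S.φ.app y) p := by
  have h1 := h.F_ξ_left_φ x (S.φ.app y) p
  rw [S.F_φφ_right, S.nablaη_φφ_right, S.F_swap_right S.ξ x S.ξ, S.F_ξ_middle,
    h.nablaη_ξ_left] at h1
  linarith

theorem FIdentity.isKilling (h : S.FIdentity) : S.g.IsKilling S.ξ :=
  S.isKilling_iff.2 h.nablaη_skew

theorem FIdentity.isTotallySkew_N₃ (h : S.FIdentity) : IsTotallySkew S.N₃ where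
  skew_left x y z := by
    funext p
    simp only [Pi.neg_apply, N₃_apply]
    ring
  skew_right x y z := by
    funext p
    simp only [Pi.neg_apply, N₃_apply]
    -- The identity and skewness of ∇η reduce N(x,y,z) to 2(F(φx,y,z) + F(x,y,φz) - (∇_xη)y η(z)),
    -- whose skewness in y, z holds without (i).
    linear_combination -2 * S.F_φ_middle x y z p - h x y z p - h x z y p
      + 2 * S.F_swap_right (S.φ.app x) y z p + 2 * S.F_swap_right x (S.φ.app y) z p
      + S.η p (z p) * h.nablaη_skew x y p + S.η p (y p) * h.nablaη_skew x z p

theorem FIdentity.of_isTotallySkew_N₃ (h : IsTotallySkew S.N₃) (hξ : S.g.IsKilling S.ξ) :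
    S.FIdentity := by
  rw [isKilling_iff] at hξ
  let P (x y z : 𝔛 E M) (p : M) : ℝ :=
    S.F (S.φ.app x) y z p + S.F x y (S.φ.app z) p - S.nablaη x y p * S.η p (z p)
  have hP (x y z : 𝔛 E M) (p : M) : P x y z p + P x z y p = 0 := by
    simp only [P]
    linear_combination -S.F_φ_middle x y z p
      + S.F_swap_right (S.φ.app x) y z p + S.F_swap_right x (S.φ.app y) z p
  have hN (x y z : 𝔛 E M) (p : M) : S.N₃ x y z p = P x y z p - P y x z p := by
    simp only [P, N₃_apply]
    ring
  -- In N(y,x,z) = -N(y,z,x) the two terms P(y,·,·) cancel by `hP`. What remains is skewness of P in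
  -- its outer arguments, and together with `hP` this generates total skewness.
  have hP' (x y z : 𝔛 E M) (p : M) : P x y z p + P z y x p = 0 := by
    have h1 := congrFun (h.skew_right y x z) p
    rw [Pi.neg_apply, hN, hN] at h1
    linarith [hP x y z p, hP z x y p, hP y x z p]
  intro x y z p
  have h1 : P x y z p + P y x z p = 0 := by
    linarith [hP x y z p, hP' x z y p, hP y z x p]
  simp only [P] at h1
  linear_combination h1 + S.η p (z p) * hξ x y p

/-! ### The explicit torsion T and the connection ∇ + T/2 -/

variable (S)

/-- The torsion tensor of the natural connection with totally skew-symmetric torsion. -/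
noncomputable def skewTorsion (x y z : 𝔛 E M) (p : M) : ℝ :=
  S.F x y (S.φ.app z) p - S.F y x (S.φ.app z) p - S.F (S.φ.app z) x y p
    - 2 * S.nablaη x y p * S.η p (z p)

variable {S}

theorem FIdentity.skewTorsion_skew_left (h : S.FIdentity) (x y z : 𝔛 E M) (p : M) :
    S.skewTorsion x y z p = -S.skewTorsion y x z p := by
  simp only [skewTorsion]
  linear_combination -S.F_swap_right (S.φ.app z) x y p - 2 * S.η p (z p) * h.nablaη_skew x y p

theorem FIdentity.skewTorsion_skew_right (h : S.FIdentity) (x y z : 𝔛 E M) (p : M) :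
    S.skewTorsion x y z p = -S.skewTorsion x z y p := by
  simp only [skewTorsion]
  -- In T(x,y,z) + T(x,z,y) the two F(x,·,·) terms cancel up to η-terms, the other four form the
  -- identity at (y, z, x), and skewness of ∇η removes the rest.
  linear_combination h y z x p - S.F_φ_middle x y z p + S.F_swap_right x (S.φ.app y) z p
    - S.F_swap_right (S.φ.app z) x y p - S.F_swap_right (S.φ.app y) x z p
    - S.F_swap_right y x (S.φ.app z) p + S.F_φ_middle y z x p
    - S.F_swap_right z x (S.φ.app y) p + S.F_φ_middle z y x p
    - S.η p (z p) * h.nablaη_skew x y p - S.η p (y p) * h.nablaη_skew x z p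
    - S.η p (x p) * h.nablaη_skew y z p

/-- This is what makes φ parallel for ∇ + T/2. Modulo η-terms, F(x,φy,φz) and F(x,y,φ²z) each
contribute -F(x,y,z), and the remaining terms form the identity at (y, z, φx). -/
theorem FIdentity.skewTorsion_φ (h : S.FIdentity) (x y z : 𝔛 E M) (p : M) :
    S.skewTorsion x (S.φ.app y) z p + S.skewTorsion x y (S.φ.app z) p = -2 * S.F x y z p := by
  have e (x y : 𝔛 E M) : S.F x y S.ξ p = S.nablaη x (S.φ.app y) p := by
    rw [S.F_swap_right, S.F_ξ_middle, neg_neg]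
  have e' (x y z : 𝔛 E M) : S.F x (S.φ.app y) (S.φ.app z) p
      = -S.F x y z p + S.η p (z p) * S.nablaη x (S.φ.app y) p
        - S.η p (y p) * S.nablaη x (S.φ.app z) p := by
    rw [S.F_φ_middle, S.F_φφ_right, e, S.η_app_apply_φ]
    ring
  have h1 := h y z (S.φ.app x) p
  rw [S.F_φφ_right, S.F_φφ_right, e, e] at h1
  simp only [skewTorsion, e', S.F_φφ_left, S.F_φφ_right, e, S.η_app_apply_φ, h.F_ξ_left]
  linear_combination h1 - S.F_swap_right (S.φ.app y) z (S.φ.app x) p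
    - S.F_swap_right (S.φ.app z) y (S.φ.app x) p + S.F_φ_middle (S.φ.app y) x z p
    + S.F_φ_middle (S.φ.app z) x y p + S.F_swap_right y z x p + S.F_swap_right z y x p
    - S.η p (x p) * h.nablaη_skew (S.φ.app y) z p - S.η p (x p) * h.nablaη_skew (S.φ.app z) y p
    - S.η p (z p) * h.nablaη_skew (S.φ.app y) x p - S.η p (y p) * h.nablaη_skew (S.φ.app z) x p
    - S.η p (z p) * h.nablaη_skew y (S.φ.app x) p

theorem skewTorsion_ξ (x y : 𝔛 E M) (p : M) :
    S.skewTorsion x y S.ξ p = -2 * S.nablaη x y p := by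
  simp only [skewTorsion, S.F_φ_ξ_right, S.F_φ_ξ_left, S.η_ξ]
  ring

variable (S)

theorem exists_skewTorsion_dual (x y : 𝔛 E M) : ∃ V : 𝔛 E M, ∀ (z : 𝔛 E M) (p : M),
    S.g.val p (V p) (z p) = 2⁻¹ * S.skewTorsion x y z p := by
  obtain ⟨A, hA⟩ := S.g.exists_dual_leviCivita (S.φ.app x) y
  obtain ⟨B, hB⟩ := S.g.exists_dual_leviCivita x (S.φ.app y)
  -- `A` and `B` represent the two halves of F(·, x, y). Replacing z by φz in an F-term applies -φ
  -- to its dual vector, and η(z) = -g(ξ, z) accounts for the ξ-term.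
  refine ⟨(2⁻¹ : ℝ) • (S.φ.app (A + B + (leviCivita S.g).covEnd S.φ y x
    - (leviCivita S.g).covEnd S.φ x y)) + -fmul (S.g.smoothApp ((leviCivita S.g).D x S.ξ) y) S.ξ,
    fun z p => ?_⟩
  have h1 := hA (S.φ.app z) p
  have h2 := hB (S.φ.app z) p
  simp only [EndField.app_apply] at h1 h2
  simp only [skewTorsion, F_apply S (S.φ.app z)]
  simp only [F, Metric.app, nablaη_eq, ContMDiffSection.coe_smul, Pi.smul_apply,
    section_add_apply, section_sub_apply, section_neg_apply, EndField.app_apply, fmul_apply,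
    Metric.smoothApp_apply, map_add, map_sub, map_neg, map_smul, add_apply, sub_apply, neg_apply,
    smul_apply, smul_eq_mul, S.g_φ_left, S.g_ξ_left, h1, h2]
  ring

theorem skewTorsion_add_left (x x' y z : 𝔛 E M) (p : M) :
    S.skewTorsion (x + x') y z p = S.skewTorsion x y z p + S.skewTorsion x' y z p := by
  simp only [skewTorsion, F, Metric.app, nablaη_eq, LinearConnection.covEnd_add_left,
    LinearConnection.covEnd_add_right, LinearConnection.add_left, section_add_apply, map_add,
    add_apply]
  ring

theorem skewTorsion_fmul_left (f : C^∞⟮𝓘(ℝ, E), M; ℝ⟯) (x y z : 𝔛 E M) (p : M) :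
    S.skewTorsion (fmul f x) y z p = f p * S.skewTorsion x y z p := by
  simp only [skewTorsion, F, Metric.app, nablaη_eq, LinearConnection.covEnd_fmul_left,
    LinearConnection.covEnd_fmul_right, LinearConnection.fmul_left, fmul_apply, map_smul,
    smul_apply, smul_eq_mul]
  ring

theorem skewTorsion_add_middle (x y y' z : 𝔛 E M) (p : M) :
    S.skewTorsion x (y + y') z p = S.skewTorsion x y z p + S.skewTorsion x y' z p := by
  simp only [skewTorsion, F, Metric.app, nablaη_eq, LinearConnection.covEnd_add_left,
    LinearConnection.covEnd_add_right, section_add_apply, map_add, add_apply]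
  ring

theorem skewTorsion_fmul_middle (f : C^∞⟮𝓘(ℝ, E), M; ℝ⟯) (x y z : 𝔛 E M) (p : M) :
    S.skewTorsion x (fmul f y) z p = f p * S.skewTorsion x y z p := by
  simp only [skewTorsion, F, Metric.app, nablaη_eq, LinearConnection.covEnd_fmul_left,
    LinearConnection.covEnd_fmul_right, fmul_apply, map_smul, smul_apply, smul_eq_mul]
  ring

/-- There is a linear connection `∇ + T / 2`, where `T` is the tensor `skewTorsion`. -/
theorem exists_connection_skewTorsion [T2Space M] : ∃ D : LinearConnection E M,
    ∀ (x y z : 𝔛 E M) (p : M), S.g.val p (D.D x y p) (z p)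
      = S.g.val p ((leviCivita S.g).D x y p) (z p) + 2⁻¹ * S.skewTorsion x y z p := by
  choose Q hQ using S.exists_skewTorsion_dual
  -- Nondegeneracy makes the chosen dual vector unique, so Q inherits linearity over smooth
  -- functions from T.
  have add_left (x x' y : 𝔛 E M) : Q (x + x') y = Q x y + Q x' y := by
    refine S.g.eq_of_app_eq fun z => funext fun p => ?_
    simp only [Metric.app, section_add_apply, map_add, add_apply, hQ, skewTorsion_add_left]
    ring
  have fmul_left (f : C^∞⟮𝓘(ℝ, E), M; ℝ⟯) (x y : 𝔛 E M) : Q (fmul f x) y = fmul f (Q x y) := by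
    refine S.g.eq_of_app_eq fun z => funext fun p => ?_
    simp only [Metric.app, fmul_apply, map_smul, smul_apply, hQ, skewTorsion_fmul_left,
      smul_eq_mul]
    ring
  have add_right (x y y' : 𝔛 E M) : Q x (y + y') = Q x y + Q x y' := by
    refine S.g.eq_of_app_eq fun z => funext fun p => ?_
    simp only [Metric.app, section_add_apply, map_add, add_apply, hQ, skewTorsion_add_middle]
    ring
  have fmul_right (f : C^∞⟮𝓘(ℝ, E), M; ℝ⟯) (x y : 𝔛 E M) : Q x (fmul f y) = fmul f (Q x y) := by
    refine S.g.eq_of_app_eq fun z => funext fun p => ?_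
    simp only [Metric.app, fmul_apply, map_smul, smul_apply, hQ, skewTorsion_fmul_middle,
      smul_eq_mul]
    ring
  refine ⟨⟨fun x y => (leviCivita S.g).D x y + Q x y, ?_, ?_, ?_, ?_⟩, ?_⟩
  · intro x x' y
    rw [LinearConnection.add_left, add_left]
    abel
  · intro f x y
    ext1 p
    simp only [LinearConnection.fmul_left, fmul_left, section_add_apply, fmul_apply, smul_add]
  · intro x y y'
    rw [LinearConnection.add_right, add_right]
    abel
  · intro f x y p
    simp only [section_add_apply, LinearConnection.leibniz, fmul_right, fmul_apply, smul_add,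
      add_assoc]
  · intro x y z p
    simp only [section_add_apply, map_add, add_apply, hQ]

variable {S}

theorem torsion₃_apply (D : LinearConnection E M) (x y z : 𝔛 E M) (p : M) :
    D.torsion₃ S.g x y z p
      = S.g.val p (D.D x y p) (z p) - S.g.val p ((leviCivita S.g).D x y p) (z p)
        - (S.g.val p (D.D y x p) (z p) - S.g.val p ((leviCivita S.g).D y x p) (z p)) := by
  simp only [LinearConnection.torsion₃, LinearConnection.torsion, lie_eq_leviCivita S.g,
    Metric.app, section_sub_apply, map_sub, sub_apply]
  ring

theorem FIdentity.isNatural_of_eq [T2Space M] (h : S.FIdentity) {D : LinearConnection E M}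
    (hD : ∀ (x y z : 𝔛 E M) (p : M), S.g.val p (D.D x y p) (z p)
      = S.g.val p ((leviCivita S.g).D x y p) (z p) + 2⁻¹ * S.skewTorsion x y z p) :
    S.IsNatural D ∧ IsTotallySkew (D.torsion₃ S.g) := by
  have hη (x y : 𝔛 E M) (p : M) : S.η p (D.D x y p) = dir x (S.η.app y) p := by
    have h1 := hD x y S.ξ p
    rw [S.skewTorsion_ξ, S.g_ξ_right, S.g_ξ_right, S.nablaη_eq] at h1
    rw [S.dir_η_app]
    linarith
  have hg (x y z : 𝔛 E M) (p : M) : dir x (S.g.app y z) p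
      = S.g.val p (D.D x y p) (z p) + S.g.val p (y p) (D.D x z p) := by
    rw [(leviCivita S.g).dir_app (leviCivita_covMetric S.g), S.g.symm p (y p), S.g.symm p (y p),
      hD, hD, h.skewTorsion_skew_right x z y]
    ring
  have ht (x y z : 𝔛 E M) (p : M) : D.torsion₃ S.g x y z p = S.skewTorsion x y z p := by
    rw [torsion₃_apply, hD, hD, h.skewTorsion_skew_left y x]
    ring
  refine ⟨⟨fun x y => ?_, fun x => ?_, fun x y => ?_, fun x y z => ?_⟩, fun x y z => ?_,
    fun x y z => ?_⟩
  · refine S.g.eq_zero_of_app_eq_zero fun z => funext fun p => ?_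
    have h1 := hD x y (S.φ.app z) p
    have h2 := S.F_apply x y z p
    rw [EndField.app_apply] at h1
    simp only [Metric.app, LinearConnection.covEnd, section_sub_apply, EndField.app_apply, map_sub,
      sub_apply, S.g_φ_left, Pi.zero_apply]
    rw [h1, hD]
    linear_combination -h2 + 2⁻¹ * h.skewTorsion_φ x y z p
  -- Since η = -g(ξ, ·), Dξ = 0 follows from Dg = 0 and Dη = 0.
  · refine S.g.eq_zero_of_app_eq_zero fun z => funext fun p => ?_
    have h1 := hg x S.ξ z p
    have h2 : S.g.app S.ξ z = -S.η.app z := by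
      funext q
      simp [Metric.app, OneForm.app, S.g_ξ_left]
    rw [h2, S.g_ξ_left, hη] at h1
    simp only [dir, mvfderiv_neg, neg_apply] at h1
    rw [Metric.app, Pi.zero_apply]
    linarith
  · funext p
    simp [LinearConnection.covOneForm, OneForm.app, ← hη x y p]
  · funext p
    simp [LinearConnection.covMetric, Metric.app, hg x y z p]
  · funext p
    rw [Pi.neg_apply, ht, ht, h.skewTorsion_skew_left]
  · funext p
    rw [Pi.neg_apply, ht, ht, h.skewTorsion_skew_right]

/-! ### Contorsion of a natural connection: necessity and uniqueness -/

/-- The contorsion `g(D_x y - ∇_x y, z)` of `D`. -/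
noncomputable def contorsion (S : AlmostContactMetric E M) (D : LinearConnection E M)
    (x y z : 𝔛 E M) (p : M) : ℝ :=
  S.g.val p (D.D x y p) (z p) - S.g.val p ((leviCivita S.g).D x y p) (z p)

theorem IsNatural.contorsion_skew_right {D : LinearConnection E M} (hD : S.IsNatural D)
    (x y z : 𝔛 E M) (p : M) : S.contorsion D x y z p = -S.contorsion D x z y p := by
  have h1 := D.dir_app hD.g_parallel x y z p
  rw [(leviCivita S.g).dir_app (leviCivita_covMetric S.g), S.g.symm p (y p),
    S.g.symm p (y p)] at h1
  simp only [contorsion]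
  linarith

/-- The torsion is the contorsion antisymmetrized in its first two arguments. As the contorsion is
already skew in the last two, skewness of the torsion forces skewness in the outer pair, hence in
the first. -/
theorem IsNatural.contorsion_skew_left {D : LinearConnection E M} (hD : S.IsNatural D)
    (hT : IsTotallySkew (D.torsion₃ S.g)) (x y z : 𝔛 E M) (p : M) :
    S.contorsion D x y z p = -S.contorsion D y x z p := by
  have ht (x y z : 𝔛 E M) : D.torsion₃ S.g x y z p
      = S.contorsion D x y z p - S.contorsion D y x z p := torsion₃_apply D x y z p
  have h1 (x y z : 𝔛 E M) : S.contorsion D x y z p = -S.contorsion D z y x p := by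
    have h2 := congrFun (hT.skew_right y x z) p
    rw [Pi.neg_apply, ht, ht] at h2
    linarith [hD.contorsion_skew_right y x z p]
  linarith [hD.contorsion_skew_right x y z p, h1 x z y, hD.contorsion_skew_right y z x p]

theorem IsNatural.contorsion_φ {D : LinearConnection E M} (hD : S.IsNatural D)
    (x y z : 𝔛 E M) (p : M) :
    S.contorsion D x (S.φ.app y) z p + S.contorsion D x y (S.φ.app z) p = -S.F x y z p := by
  have h1 := congrArg (fun X : 𝔛 E M => S.g.val p (X p) (z p)) (hD.φ_parallel x y)
  simp only [LinearConnection.covEnd, section_sub_apply, EndField.app_apply, map_sub, sub_apply,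
    S.g_φ_left, section_zero_apply, map_zero, zero_apply] at h1
  simp only [contorsion, F_apply, EndField.app_apply]
  linarith

theorem IsNatural.contorsion_ξ {D : LinearConnection E M} (hD : S.IsNatural D)
    (x y : 𝔛 E M) (p : M) : S.contorsion D x y S.ξ p = -S.nablaη x y p := by
  have h1 := congrFun (hD.η_parallel x y) p
  simp only [LinearConnection.covOneForm, Pi.sub_apply, Pi.zero_apply, S.dir_η_app,
    OneForm.app] at h1
  rw [contorsion, S.g_ξ_right, S.g_ξ_right, S.nablaη_eq]
  linarith

theorem contorsion_φφ_right (D : LinearConnection E M) (x y z : 𝔛 E M) (p : M) :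
    S.contorsion D x y (S.φ.app (S.φ.app z)) p
      = -S.contorsion D x y z p + S.η p (z p) * S.contorsion D x y S.ξ p := by
  simp only [contorsion, EndField.app_apply, S.φ_sq, map_add, map_neg, map_smul, smul_eq_mul]
  ring

/-- Expanding each F by `contorsion_φ` yields eight contorsion terms, which cancel in pairs under
exchange of the first two arguments. -/
theorem IsNatural.fIdentity {D : LinearConnection E M} (hD : S.IsNatural D)
    (hT : IsTotallySkew (D.torsion₃ S.g)) : S.FIdentity := by
  intro x y z p
  linarith [hD.contorsion_φ (S.φ.app x) y z p, hD.contorsion_φ (S.φ.app y) x z p,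
    hD.contorsion_φ x y (S.φ.app z) p, hD.contorsion_φ y x (S.φ.app z) p,
    hD.contorsion_skew_left hT (S.φ.app x) (S.φ.app y) z p,
    hD.contorsion_skew_left hT (S.φ.app x) y (S.φ.app z) p,
    hD.contorsion_skew_left hT x (S.φ.app y) (S.φ.app z) p,
    hD.contorsion_skew_left hT x y (S.φ.app (S.φ.app z)) p]

theorem IsNatural.contorsion_eq {D : LinearConnection E M} (hD : S.IsNatural D)
    (hT : IsTotallySkew (D.torsion₃ S.g)) (x y z : 𝔛 E M) (p : M) :
    S.contorsion D x y z p = 2⁻¹ * S.skewTorsion x y z p := by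
  have hl := hD.contorsion_skew_left hT
  have hr := hD.contorsion_skew_right
  -- As in Koszul's formula, this combination of three instances of `contorsion_φ` cancels every
  -- term with φ on x or y. Taking w = φz and φ²z = -z + η(z)ξ then recovers the contorsion itself,
  -- its ξ-component being known from Dη = 0.
  have key (w : 𝔛 E M) : 2 * S.contorsion D x y (S.φ.app w) p
      = -S.F x y w p + S.F y x w p + S.F w x y p := by
    linarith [hD.contorsion_φ x y w p, hD.contorsion_φ y x w p, hD.contorsion_φ w x y p,
      hl x y (S.φ.app w) p, hr x (S.φ.app y) w p, hl x w (S.φ.app y) p,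
      hr y (S.φ.app x) w p, hl y w (S.φ.app x) p, hr w (S.φ.app x) y p]
  have h1 := key (S.φ.app z)
  rw [contorsion_φφ_right, hD.contorsion_ξ] at h1
  simp only [skewTorsion]
  linarith

theorem IsNatural.eq_of_isTotallySkew [T2Space M] {D D' : LinearConnection E M}
    (hD : S.IsNatural D) (hT : IsTotallySkew (D.torsion₃ S.g))
    (hD' : S.IsNatural D') (hT' : IsTotallySkew (D'.torsion₃ S.g)) : D = D' := by
  apply LinearConnection.ext
  funext x y
  refine S.g.eq_of_app_eq fun z => funext fun p => ?_
  have h1 := hD.contorsion_eq hT x y z p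
  rw [← hD'.contorsion_eq hT' x y z p, contorsion, contorsion] at h1
  exact sub_left_injective h1

theorem fIdentity_iff_existsUnique_isNatural [T2Space M] : S.FIdentity ↔
    ∃! D : LinearConnection E M, S.IsNatural D ∧ IsTotallySkew (D.torsion₃ S.g) := by
  constructor
  · intro h
    obtain ⟨D, hD⟩ := S.exists_connection_skewTorsion
    have hD' := h.isNatural_of_eq hD
    exact ⟨D, hD', fun D' h' => h'.1.eq_of_isTotallySkew h'.2 hD'.1 hD'.2⟩
  · rintro ⟨D, hD, -⟩
    exact hD.1.fIdentity hD.2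

/-! ### Assembly of the equivalences -/

theorem Nhat_eq_bracesφ (hξ : S.g.IsKilling S.ξ) (x y : 𝔛 E M) (p : M) :
    S.Nhat x y p = S.bracesφ x y p := by
  rw [Nhat, hξ x y]
  simp

end AlmostContactMetric

end PseudoRiemannian

/-- On a pseudo-Riemannian manifold with an almost contact metric structure, the `F`-identity of the
class, the two conditions on the associated Nijenhuis tensor, the condition on the Nijenhuis tensor,
and the unique existence of a natural connection with totally skew-symmetric torsion are
equivalent. -/
theorem theorem8 {E M : Type*} [NormedAddCommGroup E] [NormedSpace ℝ E] [FiniteDimensional ℝ E]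
    [TopologicalSpace M] [ChartedSpace E M] [IsManifold 𝓘(ℝ, E) ∞ M] [T2Space M]
    (S : PseudoRiemannian.AlmostContactMetric E M) :
    List.TFAE [
      ∀ x y z : PseudoRiemannian.𝔛 E M,
        S.F (S.φ.app x) y z + S.F (S.φ.app y) x z + S.F x y (S.φ.app z) + S.F y x (S.φ.app z) = 0,
      (∀ (x y : PseudoRiemannian.𝔛 E M) (p : M), S.Nhat x y p = 0) ∧ S.g.IsKilling S.ξ,
      (∀ x y : PseudoRiemannian.𝔛 E M, S.bracesφ x y = 0) ∧ S.g.IsKilling S.ξ,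
      PseudoRiemannian.IsTotallySkew S.N₃ ∧ S.g.IsKilling S.ξ,
      ∃! D : PseudoRiemannian.LinearConnection E M,
        S.IsNatural D ∧ PseudoRiemannian.IsTotallySkew (D.torsion₃ S.g)] := by
  rw [← S.fIdentity_iff]
  tfae_have 1 → 3 := fun h => ⟨S.fIdentity_iff_bracesφ_eq_zero.1 h, h.isKilling⟩
  tfae_have 3 → 1 := fun h => S.fIdentity_iff_bracesφ_eq_zero.2 h.1
  tfae_have 3 → 2 := fun h =>
    ⟨fun x y p => by rw [PseudoRiemannian.AlmostContactMetric.Nhat_eq_bracesφ h.2, h.1]; rfl, h.2⟩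
  tfae_have 2 → 3 := fun h =>
    ⟨fun x y => by
      ext1 p
      rw [← PseudoRiemannian.AlmostContactMetric.Nhat_eq_bracesφ h.2, h.1]; rfl, h.2⟩
  tfae_have 1 → 4 := fun h => ⟨h.isTotallySkew_N₃, h.isKilling⟩
  tfae_have 4 → 1 := fun h =>
    PseudoRiemannian.AlmostContactMetric.FIdentity.of_isTotallySkew_N₃ h.1 h.2
  tfae_have 1 ↔ 5 := PseudoRiemannian.AlmostContactMetric.fIdentity_iff_existsUnique_isNatural
  tfae_finish
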